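/- For $\tau\in\mathbb{C}$ with $\operatorname{Im}\tau>0$ let $$\vartheta_2(\tau)=\sum_{k\in\mathbb{Z}}e^{(k+\frac12)^2\pi i\tau},\qquad \vartheta_3(\tau)=\sum_{k\in\mathbb{Z}}e^{k^2\pi i\tau},\qquad \vartheta_4(\tau)=\sum_{k\in\mathbb{Z}}(-1)^k e^{k^2\pi i\tau}$$ be Jacobi's theta constants, and let $\eta(\tau)=\zeta(1\,|\,1,\tau)$ be the Weierstrass $\eta$-function, where $$\zeta(z\,|\,\omega,\omega')=\frac1z+\sum_{l\in(2\omega\mathbb{Z}+2\omega'\mathbb{Z})\setminus\{0\}}\Bigl(\frac1{z-l}+\frac1l+\frac z{l^2}\Bigr)$$ is the Weierstrass zeta function with half-periods $\omega,\omega'$ (linearly independent over $\mathbb{R}$). Theorem 5.1. The theta constants are differentially closed upon adjoining $\eta$: on the upper half-plane the functions $\vartheta_2,\vartheta_3,\vartheta_4,\eta$ are holomorphic and satisfy $$\frac{d\vartheta_2}{d\tau}=\frac{i}{\pi}\Bigl\{\eta+\frac{\pi^2}{12}(\vartheta_3^4+\vartheta_4^4)\Bigr\}\vartheta_2,\qquad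 \frac{d\vartheta_3}{d\tau}=\frac{i}{\pi}\Bigl\{\eta+\frac{\pi^2}{12}(\vartheta_2^4-\vartheta_4^4)\Bigr\}\vartheta_3,$$ $$\frac{d\vartheta_4}{d\tau}=\frac{i}{\pi}\Bigl\{\eta-\frac{\pi^2}{12}(\vartheta_2^4+\vartheta_3^4)\Bigr\}\vartheta_4,\qquad \frac{d\eta}{d\tau}=\frac{i}{\pi}\Bigl\{2\eta^2-\frac{\pi^4}{12^2}(\vartheta_2^8+\vartheta_3^8+\vartheta_4^8)\Bigr\}.$$ -/

import Mathlib

noncomputable section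

namespace ThetaSystem

/-- The theta constant `ϑ₂(τ) = ∑_{k ∈ ℤ} exp((k + 1/2)² π i τ)`. -/
def theta2 (τ : ℂ) : ℂ :=
  ∑' k : ℤ, Complex.exp (((k : ℂ) + 1 / 2) ^ 2 * (Real.pi : ℂ) * Complex.I * τ)

/-- The theta constant `ϑ₃(τ) = ∑_{k ∈ ℤ} exp(k² π i τ)`. -/
def theta3 (τ : ℂ) : ℂ :=
  ∑' k : ℤ, Complex.exp ((k : ℂ) ^ 2 * (Real.pi : ℂ) * Complex.I * τ)

/-- The theta constant `ϑ₄(τ) = ∑_{k ∈ ℤ} (-1)^k exp(k² π i τ)`. -/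
def theta4 (τ : ℂ) : ℂ :=
  ∑' k : ℤ, (-1 : ℂ) ^ k * Complex.exp ((k : ℂ) ^ 2 * (Real.pi : ℂ) * Complex.I * τ)

/-- The Weierstrass zeta function `ζ(z | ω, ω')` with half-periods `ω, ω'`, that is, of the
lattice `2ωℤ + 2ω'ℤ`: `1/z + ∑_{l ≠ 0} (1/(z - l) + 1/l + z/l²)`. -/
def weierstrassZeta (ω ω' z : ℂ) : ℂ :=
  1 / z + ∑' p : {p : ℤ × ℤ // p ≠ 0},
    let l : ℂ := 2 * (p.1.1 : ℂ) * ω + 2 * (p.1.2 : ℂ) * ω'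
    1 / (z - l) + 1 / l + z / l ^ 2

/-- The Weierstrass eta function `η(τ) = ζ(1 | 1, τ)`. -/
def weierstrassEta (τ : ℂ) : ℂ := weierstrassZeta 1 τ 1

end ThetaSystem

end

open UpperHalfPlane hiding I
open Complex Filter Topology Derivative ModularForm MatrixGroups Manifold EisensteinSeries
open SummationFilter
open scoped Real

/-! Write `D` for `(2πi)⁻¹ d/dτ` and `a, b, c` for the fourth powers of `ϑ₂, ϑ₃, ϑ₄`. Symmetrizing
the lattice sum under `l ↦ -l` and telescoping along rows gives `η = (π²/12) E₂`
(`weierstrassEta_eq_E2`), so everything becomes a statement about `E₂, a, b, c`. The generators `S`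
and `T` permute `a, b, c` up to sign, and level-one rigidity supplies the relations: cusp forms of
weight below 12 vanish, those of weight 12 are multiples of `Δ`, and weight-0 forms are constant.

Jacobi's identity `b = a + c` and the equation for `D E₂` come from weight 4. In weight 12, `(abc)²`
is a multiple of `Δ`, whose logarithmic derivative is `E₂`; hence `2 D(abc) = E₂ abc`
(`two_mul_normalizedDeriv_thetaProd`). In weight 6, the Wronskian of `a` and `c` has the same sign
character as `abc`, so their quotient is constant (`thetaWronskian_eq`). These two equations are
linear in `Da` and `Dc`; solving them (`normalizedDeriv_thetaFour`) and dividing logarithmic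
derivatives by 4 gives the theta equations. -/

namespace ThetaSystem

/-! ### Rigidity of level-one forms and decay of derivatives at `i∞` -/

section LevelOne

/-- The modular form of level one with a given underlying function that has a limit at `i∞`. -/
noncomputable def modularFormOfTendsto {k : ℤ} (F : ℍ → ℂ)
    (hS : F ∣[k] ModularGroup.S = F) (hT : F ∣[k] ModularGroup.T = F) (hF : MDiff F)
    {c : ℂ} (hc : Tendsto F atImInfty (𝓝 c)) : ModularForm 𝒮ℒ k where
  toFun := F
  slash_action_eq' A hA := by
    obtain ⟨A, rfl⟩ := hA
    exact SlashInvariantForm.slash_action_generators_SL2Z hS hT A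
  holo' := hF
  bdd_at_cusps' hx := by
    rw [Subgroup.IsArithmetic.isCusp_iff_isCusp_SL2Z] at hx
    rw [OnePoint.isBoundedAt_iff_forall_SL2Z hx]
    intro γ _
    rw [SlashInvariantForm.slash_action_generators_SL2Z hS hT]
    exact hc.isBigO_one ℝ

/-- The cusp form of level one with a given underlying function that vanishes at `i∞`. -/
noncomputable def cuspFormOfTendsto {k : ℤ} (F : ℍ → ℂ)
    (hS : F ∣[k] ModularGroup.S = F) (hT : F ∣[k] ModularGroup.T = F) (hF : MDiff F)
    (hc : Tendsto F atImInfty (𝓝 0)) : CuspForm 𝒮ℒ k where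
  toFun := F
  slash_action_eq' A hA := by
    obtain ⟨A, rfl⟩ := hA
    exact SlashInvariantForm.slash_action_generators_SL2Z hS hT A
  holo' := hF
  zero_at_cusps' hx := by
    rw [Subgroup.IsArithmetic.isCusp_iff_isCusp_SL2Z] at hx
    rw [OnePoint.isZeroAt_iff_forall_SL2Z hx]
    intro γ _
    rw [SlashInvariantForm.slash_action_generators_SL2Z hS hT]
    exact hc

lemma eq_zero_of_tendsto_zero_of_weight_lt_twelve {k : ℤ} (hk : k < 12) {F : ℍ → ℂ}
    (hS : F ∣[k] ModularGroup.S = F) (hT : F ∣[k] ModularGroup.T = F) (hF : MDiff F)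
    (hc : Tendsto F atImInfty (𝓝 0)) : F = 0 :=
  congrArg DFunLike.coe (rank_zero_iff_forall_zero.mp
    (CuspForm.rank_eq_zero_of_weight_lt_twelve hk) (cuspFormOfTendsto F hS hT hF hc))

lemma eq_const_of_weight_zero {F : ℍ → ℂ}
    (hS : F ∣[(0 : ℤ)] ModularGroup.S = F) (hT : F ∣[(0 : ℤ)] ModularGroup.T = F) (hF : MDiff F)
    {c : ℂ} (hc : Tendsto F atImInfty (𝓝 c)) (τ : ℍ) : F τ = c := by
  obtain ⟨d, hd⟩ := ModularFormClass.levelOne_weight_zero_const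
    (modularFormOfTendsto F hS hT hF hc)
  have hd' : F = Function.const _ d := hd
  subst hd'
  exact tendsto_nhds_unique tendsto_const_nhds hc

lemma exists_eq_mul_discriminant {F : ℍ → ℂ}
    (hS : F ∣[(12 : ℤ)] ModularGroup.S = F) (hT : F ∣[(12 : ℤ)] ModularGroup.T = F) (hF : MDiff F)
    (hc : Tendsto F atImInfty (𝓝 0)) : ∃ c : ℂ, F = c • discriminant := by
  obtain ⟨c, h⟩ := CuspForm.exists_smul_discriminant_of_weight_eq_twelve
    (cuspFormOfTendsto F hS hT hF hc)
  exact ⟨c, (congrArg DFunLike.coe h).symm⟩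

/-- A Cauchy estimate: derivatives of functions bounded at `i∞` vanish at `i∞`. -/
lemma tendsto_normalizedDeriv_zero {F : ℍ → ℂ} (hF : MDiff F) {c : ℂ}
    (hc : Tendsto F atImInfty (𝓝 c)) :
    Tendsto (normalizedDerivOfComplex F) atImInfty (𝓝 0) := by
  obtain ⟨M, hM⟩ := (hc.isBigO_one ℝ).bound
  obtain ⟨A, hA⟩ := (UpperHalfPlane.atImInfty_mem _).mp hM
  rw [UpperHalfPlane.mdifferentiable_iff] at hF
  have hb : ∀ᶠ τ : ℍ in atImInfty, ‖normalizedDerivOfComplex F τ‖ ≤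
      ‖(2 * π * I : ℂ)⁻¹‖ * (M / (τ.im / 2)) := by
    -- Above height `2|A|`, the disc of radius `Im τ / 2` about `τ` stays where `F` is bounded by
    -- `M`.
    refine (UpperHalfPlane.atImInfty_mem _).mpr ⟨2 * |A|, fun τ hτ ↦ ?_⟩
    have hr : 0 < τ.im / 2 := by have := τ.im_pos; positivity
    have him : ∀ z ∈ Metric.closedBall (τ : ℂ) (τ.im / 2), τ.im / 2 ≤ z.im := by
      intro z hz
      have h1 := (Complex.abs_im_le_norm (z - τ)).trans (mem_closedBall_iff_norm.mp hz)
      have h2 := abs_le.mp h1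
      simp only [sub_im, coe_im] at h2
      linarith [h2.1]
    rw [Set.mem_ofPred_eq, normalizedDerivOfComplex, norm_mul]
    gcongr
    refine norm_deriv_le_of_forall_mem_sphere_norm_le hr ⟨?_, ?_⟩ fun z hz ↦ ?_
    · exact hF.mono fun z hz ↦ hr.trans_le (him z (Metric.ball_subset_closedBall hz))
    · rw [closure_ball _ hr.ne']
      exact hF.continuousOn.mono fun z hz ↦ hr.trans_le (him z hz)
    · have hz' := him z (Metric.sphere_subset_closedBall hz)
      have hz0 : 0 < z.im := hr.trans_le hz'
      have := hA ⟨z, hz0⟩ (by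
        change A ≤ z.im
        have := le_abs_self A
        linarith)
      simpa [ofComplex_apply_of_im_pos hz0] using this
  refine squeeze_zero_norm' hb ?_
  have him : Tendsto (fun τ : ℍ ↦ τ.im / 2) atImInfty atTop :=
    (tendsto_comap).atTop_div_const two_pos
  simpa using (him.const_div_atTop M).const_mul ‖(2 * π * I : ℂ)⁻¹‖

end LevelOne

/-! ### Theta constants as values of the two-variable theta function -/

lemma theta3_eq_jacobiTheta₂ (τ : ℂ) : theta3 τ = jacobiTheta₂ 0 τ :=
  tsum_congr fun n ↦ by
    rw [jacobiTheta₂_term]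
    ring_nf

lemma neg_one_zpow_eq_exp (n : ℤ) : (-1 : ℂ) ^ n = cexp (π * I * n) := by
  rw [← exp_pi_mul_I, ← exp_int_mul, mul_comm]

lemma theta4_eq_jacobiTheta₂ (τ : ℂ) : theta4 τ = jacobiTheta₂ (1 / 2) τ :=
  tsum_congr fun n ↦ by
    rw [jacobiTheta₂_term, neg_one_zpow_eq_exp, ← Complex.exp_add]
    ring_nf

lemma theta2_eq_jacobiTheta₂ (τ : ℂ) :
    theta2 τ = cexp (π * I * τ / 4) * jacobiTheta₂ (τ / 2) τ := by
  rw [jacobiTheta₂, ← tsum_mul_left]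
  refine tsum_congr fun n ↦ ?_
  rw [jacobiTheta₂_term, ← Complex.exp_add]
  ring_nf

/-! ### Holomorphy of the theta constants -/

section Differentiability

lemma differentiableAt_theta3 {τ : ℂ} (hτ : 0 < τ.im) : DifferentiableAt ℂ theta3 τ := by
  rw [funext theta3_eq_jacobiTheta₂]
  exact differentiableAt_jacobiTheta₂_snd 0 hτ

lemma differentiableAt_theta4 {τ : ℂ} (hτ : 0 < τ.im) : DifferentiableAt ℂ theta4 τ := by
  rw [funext theta4_eq_jacobiTheta₂]
  exact differentiableAt_jacobiTheta₂_snd _ hτ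

lemma differentiableAt_jacobiTheta₂_half {τ : ℂ} (hτ : 0 < τ.im) :
    DifferentiableAt ℂ (fun τ ↦ jacobiTheta₂ (τ / 2) τ) τ :=
  (hasFDerivAt_jacobiTheta₂ (τ / 2) hτ).differentiableAt.comp
    (f := fun τ : ℂ ↦ (τ / 2, τ)) τ (by fun_prop)

lemma differentiableAt_theta2 {τ : ℂ} (hτ : 0 < τ.im) : DifferentiableAt ℂ theta2 τ := by
  rw [funext theta2_eq_jacobiTheta₂]
  exact DifferentiableAt.mul (by fun_prop) (differentiableAt_jacobiTheta₂_half hτ)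

lemma mdifferentiable_restrict {f : ℂ → ℂ} (hf : ∀ τ : ℂ, 0 < τ.im → DifferentiableAt ℂ f τ) :
    MDiff (fun τ : ℍ ↦ f τ) := by
  rw [UpperHalfPlane.mdifferentiable_iff]
  refine DifferentiableOn.congr (f := f) (fun z hz ↦ (hf z hz).differentiableWithinAt) ?_
  intro z hz
  simp [ofComplex_apply_of_im_pos hz]

end Differentiability

/-! ### Behaviour under `τ + 1` and `-1/τ` -/

section Transformation

lemma exp_pi_mul_I_int_sq (n : ℤ) : cexp ((n : ℂ) ^ 2 * π * I) = (-1) ^ n := by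
  have h : (-1 : ℂ) ^ n = (-1) ^ (n ^ 2) := by
    rcases Int.even_or_odd n with h | h
    · rw [h.neg_one_zpow, (h.pow_of_ne_zero two_ne_zero).neg_one_zpow]
    · rw [h.neg_one_zpow, h.pow.neg_one_zpow]
  rw [h, neg_one_zpow_eq_exp]
  push_cast
  ring_nf

lemma theta3_add_one (τ : ℂ) : theta3 (τ + 1) = theta4 τ :=
  tsum_congr fun n ↦ by
    rw [← exp_pi_mul_I_int_sq, ← Complex.exp_add]
    ring_nf

lemma theta4_add_one (τ : ℂ) : theta4 (τ + 1) = theta3 τ :=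
  tsum_congr fun n ↦ by
    have h : (-1 : ℂ) ^ n * (-1) ^ n = 1 := by
      rw [← mul_zpow]; simp
    rw [mul_add, mul_one, Complex.exp_add, exp_pi_mul_I_int_sq, mul_left_comm, h, mul_one]

lemma theta2_add_one (τ : ℂ) : theta2 (τ + 1) = cexp (π * I / 4) * theta2 τ := by
  rw [theta2, theta2, ← tsum_mul_left]
  refine tsum_congr fun n ↦ ?_
  have h : cexp ((n * (n + 1) : ℂ) * (π * I)) = 1 := by
    obtain ⟨m, hm⟩ := Int.even_mul_succ_self n
    have hm' : (n * (n + 1) : ℂ) = m + m := by exact_mod_cast hm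
    rw [hm', exp_eq_one_iff]
    exact ⟨m, by ring⟩
  rw [show ((n : ℂ) + 1 / 2) ^ 2 * π * I * (τ + 1) = n * (n + 1) * (π * I) +
    (π * I / 4 + ((n : ℂ) + 1 / 2) ^ 2 * π * I * τ) by ring, Complex.exp_add, h, one_mul,
    Complex.exp_add]

variable {τ : ℂ}

/-- The fourth power removes the choice of square root in the functional equation; this is why
fourth powers are used throughout. -/
lemma inv_sqrt_pow_four : (1 / (-I * τ) ^ (1 / 2 : ℂ)) ^ 4 = (-τ ^ 2)⁻¹ := by
  rw [div_pow, one_pow, ← cpow_nat_mul, one_div]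
  norm_num [mul_pow]

lemma theta3_pow_four_eq : theta3 τ ^ 4 = (-τ ^ 2)⁻¹ * theta3 (-1 / τ) ^ 4 := by
  rw [theta3_eq_jacobiTheta₂, theta3_eq_jacobiTheta₂, jacobiTheta₂_functional_equation, mul_pow,
    mul_pow, inv_sqrt_pow_four]
  simp

lemma theta4_pow_four_eq : theta4 τ ^ 4 = (-τ ^ 2)⁻¹ * theta2 (-1 / τ) ^ 4 := by
  rw [theta4_eq_jacobiTheta₂, theta2_eq_jacobiTheta₂, jacobiTheta₂_functional_equation, mul_assoc,
    mul_pow, inv_sqrt_pow_four, ← jacobiTheta₂_neg_left (1 / 2 / τ)]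
  ring_nf

lemma theta2_pow_four_eq (h : τ ≠ 0) : theta2 τ ^ 4 = (-τ ^ 2)⁻¹ * theta4 (-1 / τ) ^ 4 := by
  have h1 : -1 / (-1 / τ) = τ := by field_simp
  rw [theta4_pow_four_eq (τ := -1 / τ), h1]
  field_simp

end Transformation

/-! ### Limits of theta series at `i∞` -/

section Limits

lemma tendsto_im_atImInfty : Tendsto UpperHalfPlane.im atImInfty atTop := tendsto_comap

lemma tendsto_jacobiTheta₂_term_zero {z : ℍ → ℂ} {s : ℝ} (n : ℤ)
    (hz : ∀ τ : ℍ, (z τ).im = s * τ.im) (hn : 0 < n ^ 2 + 2 * s * n) :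
    Tendsto (fun τ : ℍ ↦ jacobiTheta₂_term n (z τ) τ) atImInfty (𝓝 0) := by
  rw [tendsto_zero_iff_norm_tendsto_zero]
  have h (τ : ℍ) : ‖jacobiTheta₂_term n (z τ) τ‖ =
      rexp (-(π * (n ^ 2 + 2 * s * n) * τ.im)) := by
    rw [norm_jacobiTheta₂_term, hz, coe_im]
    ring_nf
  simp_rw [h]
  exact Real.tendsto_exp_neg_atTop_nhds_zero.comp
    (tendsto_im_atImInfty.const_mul_atTop (mul_pos Real.pi_pos hn))

/-- Termwise limits of theta series at `i∞`. -/
lemma tendsto_jacobiTheta₂_atImInfty {z : ℍ → ℂ} {s : ℝ} (hs : |s| ≤ 1 / 2)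
    (hz : ∀ τ : ℍ, (z τ).im = s * τ.im) {a : ℤ → ℂ}
    (ha : ∀ n, Tendsto (fun τ : ℍ ↦ jacobiTheta₂_term n (z τ) τ) atImInfty (𝓝 (a n))) :
    Tendsto (fun τ : ℍ ↦ jacobiTheta₂ (z τ) τ) atImInfty (𝓝 (∑' n, a n)) := by
  -- The dominating series is `exp(-π(n² - |n|))`, the worst case of `|s| ≤ 1/2` and `Im τ ≥ 1`.
  have hsum := summable_pow_mul_jacobiTheta₂_term_bound (1 / 2) one_pos 0
  refine tendsto_tsum_of_dominated_convergence hsum ha ?_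
  filter_upwards [tendsto_im_atImInfty.eventually_ge_atTop 1] with τ hτ n
  rw [norm_jacobiTheta₂_term, hz, coe_im, pow_zero, one_mul, Real.exp_le_exp]
  have h1 : (0 : ℝ) ≤ n ^ 2 - |n| := by
    have : (0 : ℤ) ≤ n ^ 2 - |n| := by
      rcases eq_or_ne n 0 with rfl | h
      · simp
      · have := Int.one_le_abs h
        nlinarith [sq_abs n]
    exact_mod_cast this
  have h2 : |s * n| ≤ 1 / 2 * |(n : ℝ)| := by
    rw [abs_mul]; gcongr
  have h3 := neg_le_of_abs_le h2
  have h4 : (n : ℝ) ^ 2 - |(n : ℝ)| ≤ (n ^ 2 + 2 * (s * n)) * τ.im := by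
    have h1' : (0 : ℝ) ≤ n ^ 2 - |(n : ℝ)| := by exact_mod_cast h1
    have h5 : (n : ℝ) ^ 2 - |(n : ℝ)| ≤ n ^ 2 + 2 * (s * n) := by linarith
    nlinarith
  have := mul_le_mul_of_nonneg_left h4 Real.pi_pos.le
  push_cast
  linarith

lemma tendsto_jacobiTheta₂_const {r : ℝ} :
    Tendsto (fun τ : ℍ ↦ jacobiTheta₂ r τ) atImInfty (𝓝 1) := by
  have h := tendsto_jacobiTheta₂_atImInfty (z := fun _ ↦ (r : ℂ)) (s := 0) (by norm_num) (by simp)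
    (a := Pi.single 0 1) fun n ↦ by
      rcases eq_or_ne n 0 with rfl | hn
      · simp [jacobiTheta₂_term]
      · rw [Pi.single_eq_of_ne hn]
        exact tendsto_jacobiTheta₂_term_zero (s := 0) n (by simp) (by simp; positivity)
  rwa [tsum_pi_single] at h

lemma tendsto_theta3 : Tendsto (fun τ : ℍ ↦ theta3 τ) atImInfty (𝓝 1) := by
  simpa [theta3_eq_jacobiTheta₂] using tendsto_jacobiTheta₂_const (r := 0)

lemma tendsto_theta4 : Tendsto (fun τ : ℍ ↦ theta4 τ) atImInfty (𝓝 1) := by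
  simpa [theta4_eq_jacobiTheta₂] using tendsto_jacobiTheta₂_const (r := 1 / 2)

/-- The exponent `n² + n` vanishes exactly for `n = 0` and `n = -1`, so two terms survive. -/
lemma tendsto_jacobiTheta₂_half :
    Tendsto (fun τ : ℍ ↦ jacobiTheta₂ (τ / 2) τ) atImInfty (𝓝 2) := by
  have h := tendsto_jacobiTheta₂_atImInfty (z := fun τ ↦ (τ : ℂ) / 2) (s := 1 / 2)
    (by norm_num [abs_of_pos]) (fun τ ↦ by simp; ring)
    (a := fun n ↦ Pi.single (M := fun _ ↦ ℂ) 0 1 n + Pi.single (M := fun _ ↦ ℂ) (-1) 1 n) fun n ↦ by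
      rcases eq_or_ne n 0 with rfl | hn
      · simp [jacobiTheta₂_term]
      rcases eq_or_ne n (-1) with rfl | hn'
      · simp only [jacobiTheta₂_term, ne_eq, hn, not_false_eq_true, Pi.single_eq_of_ne,
          Pi.single_eq_same, zero_add]
        refine tendsto_const_nhds.congr fun τ ↦ ?_
        rw [← Complex.exp_zero]
        congr 1
        push_cast
        ring
      · rw [Pi.single_eq_of_ne hn, Pi.single_eq_of_ne hn', zero_add]
        refine tendsto_jacobiTheta₂_term_zero (s := 1 / 2) n (fun τ ↦ by simp; ring) ?_
        have : 0 < n * (n + 1) := by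
          rcases lt_or_gt_of_ne hn with h | h
          · exact mul_pos_of_neg_of_neg h (by lia)
          · positivity
        have : (0 : ℝ) < n * (n + 1) := by exact_mod_cast this
        linarith
  rw [Summable.tsum_add (hasSum_pi_single _ _).summable (hasSum_pi_single _ _).summable,
    tsum_pi_single, tsum_pi_single] at h
  norm_num at h
  exact h

end Limits

/-! ### The Weierstrass eta function and `E₂` -/

section WeierstrassEta

lemma hasSum_nat_succ_sub_self {f : ℕ → ℂ} (h0 : Tendsto f atTop (𝓝 0))
    (hs : Summable fun n ↦ f (n + 1) - f n) : HasSum (fun n ↦ f (n + 1) - f n) (-f 0) := by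
  rw [hs.hasSum_iff_tendsto_nat, ← zero_sub]
  exact (h0.sub_const (f 0)).congr fun n ↦ (Finset.sum_range_sub f n).symm

lemma hasSum_int_succ_sub_self {v : ℤ → ℂ} (h0 : Tendsto v cofinite (𝓝 0))
    (hs : Summable fun n ↦ v (n + 1) - v n) : HasSum (fun n ↦ v (n + 1) - v n) 0 := by
  rw [Int.cofinite_eq, tendsto_sup] at h0
  have h1 : HasSum (fun n : ℕ ↦ v ((n : ℤ) + 1) - v n) (-v 0) := by
    have h := hasSum_nat_succ_sub_self (f := fun n : ℕ ↦ v n)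
      (h0.2.comp tendsto_natCast_atTop_atTop)
      ((hs.comp_injective Nat.cast_injective).congr fun n ↦ by simp)
    simpa only [Nat.cast_add, Nat.cast_one, Nat.cast_zero] using h
  have h2 : HasSum (fun n : ℕ ↦ v (-((n : ℤ) + 1) + 1) - v (-((n : ℤ) + 1))) (v 0) := by
    have hinj : Function.Injective fun n : ℕ ↦ -((n : ℤ) + 1) := fun a b h ↦ by lia
    have he (n : ℕ) : -((n : ℤ) + 1) + 1 = -(n : ℤ) := by ring
    have hs' : Summable fun n : ℕ ↦ v (-((n + 1 : ℕ) : ℤ)) - v (-(n : ℤ)) := by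
      refine (hs.comp_injective hinj).neg.congr fun n ↦ ?_
      rw [Function.comp_apply, he, neg_sub, Nat.cast_add, Nat.cast_one]
    have h := (hasSum_nat_succ_sub_self (f := fun n : ℕ ↦ v (-(n : ℤ)))
      (h0.1.comp (tendsto_neg_atTop_atBot.comp tendsto_natCast_atTop_atTop)) hs').neg
    simpa only [neg_sub, neg_neg, he, Nat.cast_add, Nat.cast_one, Nat.cast_zero, neg_zero] using h
  have h := h1.of_nat_of_neg_add_one (f := fun n : ℤ ↦ v (n + 1) - v n) h2
  rwa [neg_add_cancel] at h

variable (τ : ℍ)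

/-- The lattice `2ℤ + 2τℤ`, parametrized with the coefficient of `2τ` first. -/
noncomputable def latticePoint (p : ℤ × ℤ) : ℂ := 2 * (p.1 * (τ : ℂ) + p.2)

lemma linear_add_ne_zero (m n : ℤ) (h : m ≠ 0 ∨ n ≠ 0) : (m : ℂ) * τ + n ≠ 0 := by
  have := linear_ne_zero τ (cd := ![(m : ℝ), n]) (by
    intro h'
    have h0 := congrFun h' 0
    have h1 := congrFun h' 1
    simp at h0 h1
    simp_all)
  simpa using this

lemma latticePoint_add_ne_zero (p : ℤ × ℤ) {k : ℤ} (hk : Odd k) : latticePoint τ p + k ≠ 0 := by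
  have := linear_add_ne_zero τ (2 * p.1) (2 * p.2 + k) (by right; grind)
  convert this using 1
  simp [latticePoint]
  ring

lemma latticePoint_eq_zero_iff {p : ℤ × ℤ} : latticePoint τ p = 0 ↔ p = 0 := by
  constructor
  · intro h
    by_contra hp
    refine linear_add_ne_zero τ p.1 p.2 ?_ (by simpa [latticePoint] using h)
    by_contra! h'
    exact hp (Prod.ext h'.1 h'.2)
  · rintro rfl
    simp [latticePoint]

/-- The summand of the Weierstrass eta function. -/
noncomputable def etaSummand (l : ℂ) : ℂ := 1 / (1 - l) + 1 / l + 1 / l ^ 2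

lemma isBigO_inv_latticePoint_add (k : ℤ) :
    (fun v : Fin 2 → ℤ ↦ (2 * (v 0 * (τ : ℂ) + v 1) + k)⁻¹) =O[cofinite] fun v ↦ ‖v‖⁻¹ := by
  have hinj : Function.Injective fun v : Fin 2 → ℤ ↦ (2 : ℤ) • v :=
    smul_right_injective _ two_ne_zero
  have h := (isBigO_linear_add_const_vec τ 0 k).comp_tendsto hinj.tendsto_cofinite
  refine (h.congr_left fun v ↦ ?_).trans ?_
  · simp
    ring_nf
  · refine .of_bound 1 (.of_forall fun v ↦ ?_)
    rw [Function.comp_apply, norm_smul, mul_inv]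
    have : ‖(2 : ℤ)‖⁻¹ ≤ 1 := by norm_num [Int.norm_eq_abs]
    simp only [norm_mul, norm_inv, norm_norm]
    gcongr

/-- The three fractions combine to `1 / (l² (1 - l))`, of order `‖v‖⁻³` on a rank-two lattice. -/
lemma summable_etaSummand_fin : Summable fun v : Fin 2 → ℤ ↦
    etaSummand (2 * (v 0 * (τ : ℂ) + v 1)) := by
  refine summable_of_isBigO_rpow_norm (a := 3) (by norm_num) ?_
  have h0 := isBigO_inv_latticePoint_add τ 0
  have h1 := isBigO_inv_latticePoint_add τ (-1)
  have h := ((h0.mul h0).mul h1).neg_left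
  refine (h.congr' ?_ (.of_forall fun v ↦ ?_))
  · filter_upwards [eventually_cofinite_ne 0] with v hv
    have e0 : (2 * (v 0 * (τ : ℂ) + v 1)) ≠ 0 := by
      refine (latticePoint_eq_zero_iff τ (p := (v 0, v 1))).not.mpr fun h ↦ hv ?_
      ext i
      fin_cases i
      · exact congrArg Prod.fst h
      · exact congrArg Prod.snd h
    have e1 : 2 * (v 0 * (τ : ℂ) + v 1) + (-1 : ℤ) ≠ 0 :=
      latticePoint_add_ne_zero τ (v 0, v 1) (by decide)
    generalize 2 * (v 0 * (τ : ℂ) + v 1) = l at *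
    have e2 : 1 - l ≠ 0 := fun h ↦ e1 (by push_cast; linear_combination -h)
    rw [etaSummand]
    push_cast at e1 ⊢
    rw [add_zero]
    field_simp
    ring
  · simp only
    rw [← mul_inv, ← mul_inv]
    norm_cast
    ring_nf

lemma summable_etaSummand : Summable fun p : ℤ × ℤ ↦ etaSummand (latticePoint τ p) :=
  (finTwoArrowEquiv ℤ).symm.summable_iff.mpr (summable_etaSummand_fin τ)

lemma weierstrassEta_eq_tsum :
    weierstrassEta τ = ∑' p : ℤ × ℤ, etaSummand (latticePoint τ p) := by
  have h := (Equiv.prodComm ℤ ℤ).summable_iff.mpr (summable_etaSummand τ)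
  rw [← (Equiv.prodComm ℤ ℤ).tsum_eq]
  change _ = ∑' p, ((fun p ↦ etaSummand (latticePoint τ p)) ∘ Equiv.prodComm ℤ ℤ) p
  rw [← h.tsum_subtype_add_tsum_subtype_compl {0}, tsum_singleton,
    weierstrassEta, weierstrassZeta]
  congr 1
  -- The pole term `1/z` at `z = 1` is the summand at `l = 0`, where `1 / 0 = 0` leaves 1.
  · simp [latticePoint, etaSummand]
  · refine tsum_congr fun p ↦ ?_
    have h : latticePoint τ (p.1.2, p.1.1) = 2 * p.1.1 * 1 + 2 * p.1.2 * τ := by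
      rw [latticePoint]
      ring
    simp only [← h]
    rfl

/-- Adding the summands at `±l` leaves `2/l²`, half an Eisenstein term, plus `1/(l + 1) - 1/(l -
1)`. Since `l` grows by 2 with `n`, this remainder telescopes to zero along the row. -/
lemma hasSum_etaSummand_symm (m : ℤ) :
    HasSum (fun n : ℤ ↦ etaSummand (latticePoint τ (m, n)) + etaSummand (-latticePoint τ (m, n)))
      (e2Summand m τ / 2) := by
  have hs : Summable fun n : ℤ ↦
      etaSummand (latticePoint τ (m, n)) + etaSummand (-latticePoint τ (m, n)) := by
    have h1 := (summable_etaSummand τ).prod_factor m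
    have h2 := ((Equiv.neg ℤ).summable_iff.mpr ((summable_etaSummand τ).prod_factor (-m)))
    refine (h1.add h2).congr fun n ↦ ?_
    simp [latticePoint]
    ring_nf
  have he : HasSum (fun n ↦ eisSummand 2 ![m, n] τ / 2) (e2Summand m τ / 2) :=
    (e2Summand_summable m τ).hasSum.div_const 2
  have hkey (n : ℤ) : etaSummand (latticePoint τ (m, n)) + etaSummand (-latticePoint τ (m, n)) -
      eisSummand 2 ![m, n] τ / 2 =
        (latticePoint τ (m, n + 1) + (-1 : ℤ))⁻¹ - (latticePoint τ (m, n) + (-1 : ℤ))⁻¹ := by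
    have e : latticePoint τ (m, n + 1) = latticePoint τ (m, n) + 2 := by
      simp [latticePoint]; ring
    have e1 := latticePoint_add_ne_zero τ (m, n) (k := 1) (by decide)
    have e2 := latticePoint_add_ne_zero τ (m, n) (k := -1) (by decide)
    have e3 : eisSummand 2 ![m, n] τ = 4 / latticePoint τ (m, n) ^ 2 := by
      simp only [eisSummand, latticePoint, mul_pow, Matrix.cons_val_zero, Matrix.cons_val_one,
        zpow_neg, zpow_ofNat]
      norm_num [div_eq_mul_inv, mul_inv, ← mul_assoc]
      ring
    rw [e, e3]
    generalize latticePoint τ (m, n) = l at *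
    push_cast at *
    have e4 : 1 - l ≠ 0 := fun h ↦ e2 (by linear_combination -h)
    have e5 : l + 2 + -1 ≠ 0 := fun h ↦ e1 (by linear_combination h)
    have e6 : 1 - -l ≠ 0 := fun h ↦ e1 (by linear_combination h)
    rcases eq_or_ne l 0 with rfl | h0
    · norm_num [etaSummand]
    · rw [etaSummand, etaSummand]
      field_simp
      ring
  have ht := hasSum_int_succ_sub_self (v := fun n ↦ (latticePoint τ (m, n) + (-1 : ℤ))⁻¹) ?_
    ((hs.sub he.summable).congr hkey)
  · have h := ht.add he
    simp only [← hkey, sub_add_cancel, zero_add] at h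
    exact h
  · have h1 := (linear_inv_isBigO_right_add (2 * m) (-1) (τ : ℂ)).comp_tendsto
      (mul_right_injective₀ (two_ne_zero' ℤ)).tendsto_cofinite
    have h2 : Tendsto (fun n : ℤ ↦ (((2 * n : ℤ) : ℝ))⁻¹) cofinite (𝓝 0) := by
      have hi : Function.Injective fun n : ℤ ↦ 2 * n := mul_right_injective₀ two_ne_zero
      refine Tendsto.comp (g := fun n : ℤ ↦ (n : ℝ)⁻¹) ?_ hi.tendsto_cofinite
      rw [Int.cofinite_eq, tendsto_sup]
      exact ⟨tendsto_inv_atBot_zero.comp (tendsto_intCast_atBot_iff.mpr tendsto_id),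
        tendsto_inv_atTop_zero.comp tendsto_intCast_atTop_atTop⟩
    refine (h1.trans_tendsto h2).congr fun n ↦ ?_
    simp [latticePoint]
    ring_nf

/-- The Weierstrass eta function is a multiple of the quasimodular Eisenstein series. -/
lemma weierstrassEta_eq_E2 : weierstrassEta τ = π ^ 2 / 12 * E2 τ := by
  have hs := summable_etaSummand τ
  have hs' : Summable fun p : ℤ × ℤ ↦ etaSummand (-latticePoint τ p) := by
    refine ((Equiv.neg _).summable_iff.mpr hs).congr fun p ↦ ?_
    simp [latticePoint]
    ring_nf
  have heq : ∑' p : ℤ × ℤ, etaSummand (-latticePoint τ p) = weierstrassEta τ := by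
    rw [weierstrassEta_eq_tsum, ← (Equiv.neg _).tsum_eq]
    refine tsum_congr fun p ↦ ?_
    simp [latticePoint]
    ring_nf
  have h2 : weierstrassEta τ + weierstrassEta τ = ∑' m : ℤ, e2Summand m τ / 2 := by
    nth_rw 2 [← heq]
    rw [weierstrassEta_eq_tsum, ← hs.tsum_add hs', (hs.add hs').tsum_prod]
    exact tsum_congr fun m ↦ (hasSum_etaSummand_symm τ m).tsum_eq
  have h3 : Summable fun m : ℤ ↦ e2Summand m τ / 2 :=
    (hs.add hs').prod.congr fun m ↦ (hasSum_etaSummand_symm τ m).tsum_eq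
  -- The row sums converge unconditionally, so they agree with the symmetric summation defining
  -- `G2`.
  rw [← tsum_eq_of_summable_unconditional (L := symmetricIcc ℤ) h3, tsum_div_const] at h2
  rw [E2, Pi.smul_apply, smul_eq_mul, G2, riemannZeta_two]
  have hpi : (π : ℂ) ≠ 0 := ofReal_ne_zero.mpr Real.pi_ne_zero
  field_simp
  linear_combination 12 * h2

end WeierstrassEta

/-! ### Slash action of the generators -/

lemma slash_S_apply (k : ℤ) (F : ℍ → ℂ) (τ : ℍ) :
    (F ∣[k] ModularGroup.S) τ = F (ModularGroup.S • τ) * (τ : ℂ) ^ (-k) := by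
  rw [SL_slash_apply, ModularGroup.denom_S]

lemma coe_S_smul (τ : ℍ) : ((ModularGroup.S • τ : ℍ) : ℂ) = -1 / τ := by
  rw [UpperHalfPlane.modular_S_smul]
  simp [neg_div, inv_neg]

lemma slash_T_apply (k : ℤ) (F : ℍ → ℂ) (τ : ℍ) :
    (F ∣[k] ModularGroup.T) τ = F (ModularGroup.T • τ) := by
  rw [SL_slash_apply, ModularGroup.denom_apply]
  simp [ModularGroup.T]

lemma coe_T_smul (τ : ℍ) : ((ModularGroup.T • τ : ℍ) : ℂ) = τ + 1 := by
  rw [UpperHalfPlane.modular_T_smul]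
  simp [add_comm]

/-! ### Fourth powers of theta constants and Jacobi's identity -/

section Theta

/-- `ϑ₂⁴` on the upper half-plane. -/
noncomputable def theta2Four (τ : ℍ) : ℂ := theta2 τ ^ 4

/-- `ϑ₃⁴` on the upper half-plane. -/
noncomputable def theta3Four (τ : ℍ) : ℂ := theta3 τ ^ 4

/-- `ϑ₄⁴` on the upper half-plane. -/
noncomputable def theta4Four (τ : ℍ) : ℂ := theta4 τ ^ 4

lemma theta2Four_slash_S : theta2Four ∣[(2 : ℤ)] ModularGroup.S = -theta4Four := by
  ext τ
  have h := τ.ne_zero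
  rw [slash_S_apply, Pi.neg_apply, theta2Four, theta4Four, coe_S_smul, theta4_pow_four_eq,
    zpow_neg, zpow_ofNat]
  field_simp

lemma theta3Four_slash_S : theta3Four ∣[(2 : ℤ)] ModularGroup.S = -theta3Four := by
  ext τ
  have h := τ.ne_zero
  rw [slash_S_apply, Pi.neg_apply, theta3Four, theta3Four, coe_S_smul, theta3_pow_four_eq (τ := τ),
    zpow_neg, zpow_ofNat]
  field_simp

lemma theta4Four_slash_S : theta4Four ∣[(2 : ℤ)] ModularGroup.S = -theta2Four := by
  ext τ
  have h := τ.ne_zero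
  rw [slash_S_apply, Pi.neg_apply, theta4Four, theta2Four, coe_S_smul, theta2_pow_four_eq h,
    zpow_neg, zpow_ofNat]
  field_simp

lemma theta2Four_slash_T : theta2Four ∣[(2 : ℤ)] ModularGroup.T = -theta2Four := by
  ext τ
  rw [slash_T_apply, Pi.neg_apply, theta2Four, theta2Four, coe_T_smul, theta2_add_one, mul_pow,
    ← Complex.exp_nat_mul]
  rw [show ((4 : ℕ) : ℂ) * (π * I / 4) = π * I by push_cast; ring, exp_pi_mul_I]
  ring

lemma theta3Four_slash_T : theta3Four ∣[(2 : ℤ)] ModularGroup.T = theta4Four := by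
  ext τ
  rw [slash_T_apply, theta3Four, theta4Four, coe_T_smul, theta3_add_one]

lemma theta4Four_slash_T : theta4Four ∣[(2 : ℤ)] ModularGroup.T = theta3Four := by
  ext τ
  rw [slash_T_apply, theta3Four, theta4Four, coe_T_smul, theta4_add_one]

lemma mdifferentiable_theta2Four : MDiff theta2Four :=
  mdifferentiable_restrict (f := fun τ ↦ theta2 τ ^ 4) fun _ h ↦ (differentiableAt_theta2 h).pow 4

lemma mdifferentiable_theta3Four : MDiff theta3Four :=
  mdifferentiable_restrict (f := fun τ ↦ theta3 τ ^ 4) fun _ h ↦ (differentiableAt_theta3 h).pow 4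

lemma mdifferentiable_theta4Four : MDiff theta4Four :=
  mdifferentiable_restrict (f := fun τ ↦ theta4 τ ^ 4) fun _ h ↦ (differentiableAt_theta4 h).pow 4

lemma tendsto_theta3Four : Tendsto theta3Four atImInfty (𝓝 1) := by
  have h := tendsto_theta3.pow 4
  rwa [one_pow] at h

lemma tendsto_theta4Four : Tendsto theta4Four atImInfty (𝓝 1) := by
  have h := tendsto_theta4.pow 4
  rwa [one_pow] at h

/-- The square root `exp (π i τ)` of the parameter `q`. -/
noncomputable def nome (τ : ℍ) : ℂ := cexp (π * I * τ)

/-- The factor of `ϑ₂⁴` that does not vanish at `i∞`. -/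
noncomputable def theta2FourReduced (τ : ℍ) : ℂ := jacobiTheta₂ (τ / 2) τ ^ 4

/-- Isolating the vanishing factor lets quotients be evaluated at `i∞`. -/
lemma theta2Four_eq : theta2Four = nome * theta2FourReduced := by
  ext τ
  rw [theta2Four, theta2_eq_jacobiTheta₂, mul_pow, ← Complex.exp_nat_mul, Pi.mul_apply, nome,
    theta2FourReduced]
  push_cast
  ring_nf

lemma mdifferentiable_nome : MDiff nome :=
  mdifferentiable_restrict (f := fun τ ↦ cexp (π * I * τ)) fun _ _ ↦ by fun_prop

lemma mdifferentiable_theta2FourReduced : MDiff theta2FourReduced :=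
  mdifferentiable_restrict (f := fun τ ↦ jacobiTheta₂ (τ / 2) τ ^ 4)
    fun _ h ↦ (differentiableAt_jacobiTheta₂_half h).pow 4

lemma tendsto_nome : Tendsto nome atImInfty (𝓝 0) := by
  rw [tendsto_zero_iff_norm_tendsto_zero]
  refine (Real.tendsto_exp_neg_atTop_nhds_zero.comp
    (tendsto_im_atImInfty.const_mul_atTop Real.pi_pos)).congr fun τ ↦ ?_
  simp [nome, Complex.norm_exp]

lemma tendsto_theta2FourReduced : Tendsto theta2FourReduced atImInfty (𝓝 16) := by
  have h := tendsto_jacobiTheta₂_half.pow 4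
  norm_num at h
  exact h

lemma tendsto_theta2Four : Tendsto theta2Four atImInfty (𝓝 0) := by
  rw [theta2Four_eq]
  have h := tendsto_nome.mul tendsto_theta2FourReduced
  rwa [zero_mul] at h

lemma normalizedDeriv_restrict {f : ℂ → ℂ} (F : ℍ → ℂ) (hF : ∀ τ : ℍ, F τ = f τ) (τ : ℍ) :
    normalizedDerivOfComplex F τ = (2 * π * I)⁻¹ * deriv f τ := by
  rw [normalizedDerivOfComplex]
  congr 1
  apply EventuallyEq.deriv_eq
  filter_upwards [isOpen_upperHalfPlaneSet.mem_nhds τ.2] with z hz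
  rw [Function.comp_apply, hF, ofComplex_apply_of_im_pos hz]

lemma normalizedDeriv_nome : normalizedDerivOfComplex nome = (1 / 2 : ℂ) • nome := by
  ext τ
  have hpi : (π : ℂ) ≠ 0 := ofReal_ne_zero.mpr Real.pi_ne_zero
  have h : HasDerivAt (fun τ ↦ cexp (π * I * τ)) (cexp (π * I * τ) * (π * I * 1)) τ :=
    ((hasDerivAt_id (τ : ℂ)).const_mul (π * I : ℂ)).cexp
  rw [normalizedDeriv_restrict (f := fun τ ↦ cexp (π * I * τ)) nome (fun _ ↦ rfl), h.deriv,
    Pi.smul_apply, nome, smul_eq_mul]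
  field_simp [I_ne_zero]

/-- Jacobi's identity. -/
lemma theta3Four_eq_add : theta3Four = theta2Four + theta4Four := by
  -- The defect changes sign under both `S` and `T`; its square is of level one and weight 4.
  have h : (theta2Four + theta4Four - theta3Four) * (theta2Four + theta4Four - theta3Four) = 0 := by
    refine eq_zero_of_tendsto_zero_of_weight_lt_twelve (k := 2 + 2) (by norm_num) ?_ ?_ ?_ ?_
    · rw [mul_slash_SL2, sub_eq_add_neg, SlashAction.add_slash, SlashAction.add_slash,
        SlashAction.neg_slash, theta2Four_slash_S, theta3Four_slash_S, theta4Four_slash_S]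
      ring
    · rw [mul_slash_SL2, sub_eq_add_neg, SlashAction.add_slash, SlashAction.add_slash,
        SlashAction.neg_slash, theta2Four_slash_T, theta3Four_slash_T, theta4Four_slash_T]
      ring
    · have := (mdifferentiable_theta2Four.add mdifferentiable_theta4Four).sub
        mdifferentiable_theta3Four
      exact this.mul this
    · have := (tendsto_theta2Four.add tendsto_theta4Four).sub tendsto_theta3Four
      have h := this.mul this
      norm_num at h
      exact h
  ext τ
  have := mul_self_eq_zero.mp (congrFun h τ)
  simp only [Pi.add_apply, Pi.sub_apply] at this ⊢
  linear_combination -this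

end Theta

/-! ### The differential equation of `E₂` -/

section Ramanujan

/-- For `Im τ ≥ 1` the `q`-expansion is dominated by its terms at `τ = i`. -/
lemma tendsto_E2 : Tendsto E2 atImInfty (𝓝 1) := by
  have hs (τ : ℍ) := hasSum_qExpansion_E2 (z := τ)
  have h := tendsto_tsum_of_dominated_convergence (hs UpperHalfPlane.I).summable.norm
    (𝓕 := atImInfty) (f := fun (τ : ℍ) (m : ℕ) ↦
      (if m = 0 then 1 else -24 * (ArithmeticFunction.sigma 1 m : ℂ)) • cexp (2 * π * I * τ) ^ m)
    (g := Pi.single 0 1) ?_ ?_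
  · rw [tsum_pi_single] at h
    exact h.congr fun τ ↦ (hs τ).tsum_eq
  · intro m
    rcases eq_or_ne m 0 with rfl | hm
    · simp
    · have h2 (τ : ℍ) : cexp (2 * π * I * τ) = nome τ ^ 2 := by
        rw [nome, ← Complex.exp_nat_mul]
        push_cast
        ring_nf
      simp only [h2, ← pow_mul]
      have h3 := tendsto_nome.pow (2 * m)
      rw [zero_pow (by lia)] at h3
      have h4 := h3.const_smul (if m = 0 then 1 else -24 * (ArithmeticFunction.sigma 1 m : ℂ))
      rwa [smul_zero, ← Pi.single_eq_of_ne (M := fun _ ↦ ℂ) hm 1] at h4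
  · filter_upwards [tendsto_im_atImInfty.eventually_ge_atTop 1] with τ hτ m
    rw [norm_smul, norm_smul, norm_pow, norm_pow]
    have : ‖cexp (2 * π * I * τ)‖ ≤ ‖cexp (2 * π * I * (UpperHalfPlane.I : ℍ))‖ := by
      simp only [Complex.norm_exp, Real.exp_le_exp]
      simp
      nlinarith [Real.pi_pos]
    gcongr

lemma E2_slash_S : E2 ∣[(2 : ℤ)] ModularGroup.S = E2 - fun τ : ℍ ↦ 6 * I / (π * τ) := by
  rw [E2_slash_action]
  ext τ
  have hpi : (π : ℂ) ≠ 0 := ofReal_ne_zero.mpr Real.pi_ne_zero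
  have h := τ.ne_zero
  simp only [Pi.sub_apply, Pi.smul_apply, D2_S, riemannZeta_two, smul_eq_mul]
  field_simp

lemma E2_slash_T : E2 ∣[(2 : ℤ)] ModularGroup.T = E2 := by
  rw [E2_slash_action, D2_T, smul_zero, sub_zero]

lemma normalizedDeriv_slash_T {k : ℤ} {F : ℍ → ℂ} (hF : MDiff F) :
    normalizedDerivOfComplex F ∣[k + 2] ModularGroup.T =
      normalizedDerivOfComplex (F ∣[k] ModularGroup.T) := by
  rw [normalizedDerivOfComplex_SL_slash hF]
  ext τ
  simp [ModularGroup.T]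

lemma normalizedDeriv_slash_S {k : ℤ} {F : ℍ → ℂ} (hF : MDiff F) (τ : ℍ) :
    (normalizedDerivOfComplex F ∣[k + 2] ModularGroup.S) τ =
      normalizedDerivOfComplex (F ∣[k] ModularGroup.S) τ +
        k * (2 * π * I)⁻¹ / τ * (F ∣[k] ModularGroup.S) τ := by
  rw [normalizedDerivOfComplex_SL_slash hF, Pi.sub_apply, ModularGroup.denom_S]
  simp [ModularGroup.S]
  ring

lemma normalizedDeriv_inv : normalizedDerivOfComplex (fun τ : ℍ ↦ 6 * I / (π * τ)) =
    fun τ : ℍ ↦ -3 / ((π : ℂ) ^ 2 * (τ : ℂ) ^ 2) := by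
  ext τ
  have hpi : (π : ℂ) ≠ 0 := ofReal_ne_zero.mpr Real.pi_ne_zero
  have h := τ.ne_zero
  have hd : HasDerivAt (fun τ : ℂ ↦ 6 * I / π * τ⁻¹) (6 * I / π * (-(τ ^ 2 : ℂ)⁻¹)) τ :=
    (hasDerivAt_inv h).const_mul _
  rw [normalizedDeriv_restrict (f := fun τ ↦ 6 * I / π * τ⁻¹) _ (fun τ ↦ by field_simp),
    hd.deriv]
  field_simp [I_ne_zero]
  norm_num

lemma normalizedDeriv_E2_slash_S (τ : ℍ) :
    normalizedDerivOfComplex (E2 ∣[(2 : ℤ)] ModularGroup.S) τ =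
      normalizedDerivOfComplex E2 τ + 3 / ((π : ℂ) ^ 2 * (τ : ℂ) ^ 2) := by
  rw [E2_slash_S, normalizedDerivOfComplex_sub _ _ E2_mdifferentiable, Pi.sub_apply,
    normalizedDeriv_inv]
  · ring
  · exact mdifferentiable_restrict (f := fun τ ↦ 6 * I / (π * τ)) fun z hz ↦ by
      have : z ≠ 0 := fun h ↦ by simp [h] at hz
      fun_prop (disch := simp_all)

/-- Ramanujan's differential equation for `E₂`, with `E₄` expressed by theta constants. -/
lemma normalizedDeriv_E2 (τ : ℍ) : normalizedDerivOfComplex E2 τ =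
    1 / 12 * E2 τ ^ 2 -
      1 / 24 * (theta2Four τ ^ 2 + theta3Four τ ^ 2 + theta4Four τ ^ 2) := by
  have hpi : (π : ℂ) ≠ 0 := ofReal_ne_zero.mpr Real.pi_ne_zero
  have h : normalizedDerivOfComplex E2 - ((1 / 12 : ℂ) • (E2 * E2) - (1 / 24 : ℂ) •
      (theta2Four * theta2Four + theta3Four * theta3Four + theta4Four * theta4Four)) = 0 := by
    refine eq_zero_of_tendsto_zero_of_weight_lt_twelve (k := 2 + 2) (by norm_num) ?_ ?_ ?_ ?_
    -- The anomalies of `D E₂` and of `E₂²/12` under `S` cancel.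
    · ext τ
      have h := τ.ne_zero
      simp only [sub_eq_add_neg, SlashAction.add_slash, SlashAction.neg_slash, SL_smul_slash,
        mul_slash_SL2, theta2Four_slash_S, theta3Four_slash_S, theta4Four_slash_S, Pi.add_apply,
        Pi.neg_apply, Pi.smul_apply, Pi.mul_apply, normalizedDeriv_slash_S E2_mdifferentiable,
        normalizedDeriv_E2_slash_S, congrFun E2_slash_S τ, Pi.sub_apply, smul_eq_mul]
      push_cast
      field_simp
      ring_nf
      simp only [I_sq, I_pow_three]
      ring
    · simp only [sub_eq_add_neg, SlashAction.add_slash, SlashAction.neg_slash, SL_smul_slash,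
        mul_slash_SL2, theta2Four_slash_T, theta3Four_slash_T, theta4Four_slash_T,
        normalizedDeriv_slash_T E2_mdifferentiable, E2_slash_T]
      ring_nf
    · refine (normalizedDerivOfComplex_mdifferentiable E2_mdifferentiable).sub
        (((E2_mdifferentiable.mul E2_mdifferentiable).const_smul _).sub
        (MDifferentiable.const_smul _ ?_))
      exact ((mdifferentiable_theta2Four.mul mdifferentiable_theta2Four).add
        (mdifferentiable_theta3Four.mul mdifferentiable_theta3Four)).add
        (mdifferentiable_theta4Four.mul mdifferentiable_theta4Four)
    -- The limit vanishes because `1/12 = (0 + 1 + 1)/24`.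
    · have := (tendsto_normalizedDeriv_zero E2_mdifferentiable tendsto_E2).sub
        (((tendsto_E2.mul tendsto_E2).const_smul (1 / 12 : ℂ)).sub
        ((((tendsto_theta2Four.mul tendsto_theta2Four).add
          (tendsto_theta3Four.mul tendsto_theta3Four)).add
          (tendsto_theta4Four.mul tendsto_theta4Four)).const_smul (1 / 24 : ℂ)))
      norm_num at this
      exact this
  have := congrFun h τ
  simp only [Pi.add_apply, Pi.sub_apply, Pi.mul_apply, Pi.smul_apply, smul_eq_mul,
    Pi.zero_apply] at this
  linear_combination this

end Ramanujan

/-! ### The product of fourth powers and the discriminant -/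

section Product

/-- `Δ` is the 24th power of Dedekind's eta, whose logarithmic derivative is `(πi/12) E₂`. -/
lemma normalizedDeriv_discriminant :
    normalizedDerivOfComplex discriminant = E2 * discriminant := by
  ext τ
  have hpi : (π : ℂ) ≠ 0 := ofReal_ne_zero.mpr Real.pi_ne_zero
  have h0 := eta_ne_zero τ.2
  have hd := (differentiableAt_eta_of_mem_upperHalfPlaneSet τ.2).hasDerivAt.fun_pow 24
  have hl := logDeriv_eta_eq_E2 τ
  rw [logDeriv_apply, div_eq_iff h0] at hl
  rw [normalizedDeriv_restrict (f := fun z ↦ ModularForm.eta z ^ 24) discriminant (fun _ ↦ rfl),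
    hd.deriv, hl,
    Pi.mul_apply, discriminant]
  push_cast
  field_simp [I_ne_zero]
  ring

/-- The product of the fourth powers of the theta constants. -/
noncomputable def thetaProd : ℍ → ℂ := theta2Four * theta3Four * theta4Four

lemma thetaProd_slash_S : thetaProd ∣[(2 + 2 + 2 : ℤ)] ModularGroup.S = -thetaProd := by
  rw [thetaProd, mul_slash_SL2, mul_slash_SL2, theta2Four_slash_S, theta3Four_slash_S,
    theta4Four_slash_S]
  ring

lemma thetaProd_slash_T : thetaProd ∣[(2 + 2 + 2 : ℤ)] ModularGroup.T = -thetaProd := by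
  rw [thetaProd, mul_slash_SL2, mul_slash_SL2, theta2Four_slash_T, theta3Four_slash_T,
    theta4Four_slash_T]
  ring

lemma mdifferentiable_thetaProd : MDiff thetaProd :=
  (mdifferentiable_theta2Four.mul mdifferentiable_theta3Four).mul mdifferentiable_theta4Four

/-- Squaring removes the sign under `S` and `T`. The value of `c` is irrelevant to logarithmic
derivatives; only `c ≠ 0` matters. -/
lemma exists_thetaProd_sq_eq : ∃ c : ℂ, thetaProd * thetaProd = c • discriminant := by
  refine exists_eq_mul_discriminant ?_ ?_ (mdifferentiable_thetaProd.mul mdifferentiable_thetaProd)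
    ?_
  · change (thetaProd * thetaProd) ∣[(2 + 2 + 2 + (2 + 2 + 2) : ℤ)] ModularGroup.S = _
    rw [mul_slash_SL2, thetaProd_slash_S, neg_mul_neg]
  · change (thetaProd * thetaProd) ∣[(2 + 2 + 2 + (2 + 2 + 2) : ℤ)] ModularGroup.T = _
    rw [mul_slash_SL2, thetaProd_slash_T, neg_mul_neg]
  · have h := (tendsto_theta2Four.mul tendsto_theta3Four).mul tendsto_theta4Four
    have h' := h.mul h
    norm_num at h'
    exact h'

lemma thetaProd_eq : thetaProd = nome * (theta2FourReduced * theta3Four * theta4Four) := by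
  rw [thetaProd, theta2Four_eq]
  ring

lemma nome_ne_zero (τ : ℍ) : nome τ ≠ 0 := Complex.exp_ne_zero _

lemma thetaProd_ne_zero (τ : ℍ) : thetaProd τ ≠ 0 := by
  obtain ⟨c, hc⟩ := exists_thetaProd_sq_eq
  have hc0 : c ≠ 0 := by
    rintro rfl
    -- If `c = 0`, the product stripped of `nome` would vanish identically, yet it tends to 16.
    have hz (τ : ℍ) : theta2FourReduced τ * theta3Four τ * theta4Four τ = 0 := by
      have h := congrFun hc τ
      rw [zero_smul, Pi.zero_apply, Pi.mul_apply, mul_self_eq_zero, thetaProd_eq, Pi.mul_apply] at h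
      exact (mul_eq_zero.mp h).resolve_left (nome_ne_zero τ)
    have h := (tendsto_theta2FourReduced.mul tendsto_theta3Four).mul tendsto_theta4Four
    simp only [hz] at h
    have := tendsto_nhds_unique h tendsto_const_nhds
    norm_num at this
  intro h
  have h' := congrFun hc τ
  rw [Pi.mul_apply, h, zero_mul, Pi.smul_apply, smul_eq_mul] at h'
  exact mul_ne_zero hc0 (discriminant_ne_zero τ) h'.symm

lemma two_mul_normalizedDeriv_thetaProd (τ : ℍ) :
    2 * normalizedDerivOfComplex thetaProd τ = E2 τ * thetaProd τ := by
  obtain ⟨c, hc⟩ := exists_thetaProd_sq_eq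
  have h := congrArg normalizedDerivOfComplex hc
  rw [normalizedDerivOfComplex_mul _ _ mdifferentiable_thetaProd mdifferentiable_thetaProd,
    normalizedDerivOfComplex_smul _ discriminant CuspForm.discriminant.holo',
    normalizedDeriv_discriminant,
    ← mul_smul_comm, ← hc] at h
  have h' := congrFun h τ
  simp only [Pi.add_apply, Pi.mul_apply] at h'
  refine mul_right_cancel₀ (thetaProd_ne_zero τ) ?_
  linear_combination h'

end Product

/-! ### The Wronskian of `ϑ₂⁴` and `ϑ₄⁴` -/

section Wronskian

/-- The Wronskian of `ϑ₂⁴` and `ϑ₄⁴`, written with Serre derivatives. -/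
noncomputable def thetaWronskian : ℍ → ℂ :=
  serreDerivative ((2 : ℤ) : ℂ) theta2Four * theta4Four -
    theta2Four * serreDerivative ((2 : ℤ) : ℂ) theta4Four

/-- Both factors have weight 2, so the `E₂` corrections cancel: Serre derivatives give equivariance,
ordinary ones the value. -/
lemma thetaWronskian_apply (τ : ℍ) : thetaWronskian τ =
    normalizedDerivOfComplex theta2Four τ * theta4Four τ -
      theta2Four τ * normalizedDerivOfComplex theta4Four τ := by
  simp only [thetaWronskian, serreDerivative_eq, Pi.sub_apply, Pi.mul_apply]
  ring

lemma serreDerivative_neg {k : ℂ} {F : ℍ → ℂ} (hF : MDiff F) :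
    serreDerivative k (-F) = -serreDerivative k F := by
  simpa using serreDerivative_smul k (-1) F hF

lemma wronskian_slash {F G : ℍ → ℂ} (hF : MDiff F) (hG : MDiff G) (γ : SL(2, ℤ)) :
    (serreDerivative ((2 : ℤ) : ℂ) F * G - F * serreDerivative ((2 : ℤ) : ℂ) G)
        ∣[(2 + 2 + 2 : ℤ)] γ =
      serreDerivative ((2 : ℤ) : ℂ) (F ∣[(2 : ℤ)] γ) * G ∣[(2 : ℤ)] γ -
        F ∣[(2 : ℤ)] γ * serreDerivative ((2 : ℤ) : ℂ) (G ∣[(2 : ℤ)] γ) := by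
  rw [sub_eq_add_neg, SlashAction.add_slash, SlashAction.neg_slash, mul_slash_SL2,
    mul_comm F, mul_slash_SL2, serreDerivative_slash_equivariant hF,
    serreDerivative_slash_equivariant hG, mul_comm (F ∣[(2 : ℤ)] γ), ← sub_eq_add_neg]

lemma thetaWronskian_slash_S :
    thetaWronskian ∣[(2 + 2 + 2 : ℤ)] ModularGroup.S = -thetaWronskian := by
  rw [thetaWronskian, wronskian_slash mdifferentiable_theta2Four mdifferentiable_theta4Four,
    theta2Four_slash_S, theta4Four_slash_S, serreDerivative_neg mdifferentiable_theta2Four,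
    serreDerivative_neg mdifferentiable_theta4Four]
  ring

/-- `T` sends `(a, c)` to `(-a, b)`; by Jacobi's identity `b = a + c`, and the extra `a` drops out
of the alternating form. -/
lemma thetaWronskian_slash_T :
    thetaWronskian ∣[(2 + 2 + 2 : ℤ)] ModularGroup.T = -thetaWronskian := by
  rw [thetaWronskian, wronskian_slash mdifferentiable_theta2Four mdifferentiable_theta4Four,
    theta2Four_slash_T, theta4Four_slash_T, serreDerivative_neg mdifferentiable_theta2Four,
    theta3Four_eq_add,
    serreDerivative_add _ _ _ mdifferentiable_theta2Four mdifferentiable_theta4Four]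
  ring

lemma mdifferentiable_thetaWronskian : MDiff thetaWronskian :=
  ((serreDerivative_mdifferentiable _ mdifferentiable_theta2Four).mul
    mdifferentiable_theta4Four).sub
    (mdifferentiable_theta2Four.mul (serreDerivative_mdifferentiable _ mdifferentiable_theta4Four))

/-- After cancelling `nome`, the numerator tends to `16/2`, the `1/2` coming from `D nome`, and the
denominator to 16. -/
lemma tendsto_thetaWronskian_div :
    Tendsto (thetaWronskian / thetaProd) atImInfty (𝓝 (1 / 2)) := by
  have hu := tendsto_theta2FourReduced
  have hc := tendsto_theta4Four
  have hdu := tendsto_normalizedDeriv_zero mdifferentiable_theta2FourReduced hu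
  have hdc := tendsto_normalizedDeriv_zero mdifferentiable_theta4Four hc
  have h := ((((hu.const_mul (1 / 2)).add hdu).mul hc).sub (hu.mul hdc)).div
    ((hu.mul tendsto_theta3Four).mul hc) (by norm_num)
  rw [show (1 / 2 * 16 + 0) * 1 - 16 * 0 = (8 : ℂ) by norm_num,
    show (8 : ℂ) / (16 * 1 * 1) = 1 / 2 by norm_num] at h
  refine h.congr fun τ ↦ ?_
  have hda : normalizedDerivOfComplex theta2Four τ = nome τ *
      (1 / 2 * theta2FourReduced τ + normalizedDerivOfComplex theta2FourReduced τ) := by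
    rw [theta2Four_eq, normalizedDerivOfComplex_mul _ _ mdifferentiable_nome
      mdifferentiable_theta2FourReduced, normalizedDeriv_nome]
    simp only [Pi.add_apply, Pi.mul_apply, Pi.smul_apply, smul_eq_mul]
    ring
  rw [Pi.div_apply thetaWronskian, thetaWronskian_apply, hda, thetaProd_eq, theta2Four_eq]
  simp only [Pi.mul_apply]
  rw [mul_assoc (nome τ), mul_assoc (nome τ), ← mul_sub, mul_div_mul_left _ _ (nome_ne_zero τ)]
  norm_num

lemma thetaWronskian_eq (τ : ℍ) : thetaWronskian τ = 1 / 2 * thetaProd τ := by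
  have h := eq_const_of_weight_zero (F := thetaWronskian / thetaProd) ?_ ?_
    (mdifferentiable_thetaWronskian.div mdifferentiable_thetaProd thetaProd_ne_zero)
    tendsto_thetaWronskian_div τ
  · rwa [Pi.div_apply, div_eq_iff (thetaProd_ne_zero τ)] at h
  · change (thetaWronskian / thetaProd) ∣[(2 + 2 + 2 - (2 + 2 + 2) : ℤ)] ModularGroup.S = _
    rw [div_slash_SL2, thetaWronskian_slash_S, thetaProd_slash_S, neg_div_neg_eq]
  · change (thetaWronskian / thetaProd) ∣[(2 + 2 + 2 - (2 + 2 + 2) : ℤ)] ModularGroup.T = _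
    rw [div_slash_SL2, thetaWronskian_slash_T, thetaProd_slash_T, neg_div_neg_eq]

end Wronskian

/-! ### Solving for the derivatives -/

section Derivatives

lemma normalizedDeriv_thetaFour (τ : ℍ) :
    normalizedDerivOfComplex theta2Four τ =
      1 / 6 * (E2 τ + theta3Four τ + theta4Four τ) * theta2Four τ ∧
    normalizedDerivOfComplex theta3Four τ =
      1 / 6 * (E2 τ + theta2Four τ - theta4Four τ) * theta3Four τ ∧
    normalizedDerivOfComplex theta4Four τ =
      1 / 6 * (E2 τ - theta2Four τ - theta3Four τ) * theta4Four τ := by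
  have h0 := thetaProd_ne_zero τ
  have hW := thetaWronskian_eq τ
  have hP := two_mul_normalizedDeriv_thetaProd τ
  have hJ := congrFun theta3Four_eq_add τ
  have hdJ := congrFun (congrArg normalizedDerivOfComplex theta3Four_eq_add) τ
  rw [normalizedDerivOfComplex_add _ _ mdifferentiable_theta2Four mdifferentiable_theta4Four] at hdJ
  rw [thetaWronskian_apply] at hW
  rw [thetaProd, normalizedDerivOfComplex_mul _ _
    (mdifferentiable_theta2Four.mul mdifferentiable_theta3Four) mdifferentiable_theta4Four,
    normalizedDerivOfComplex_mul _ _ mdifferentiable_theta2Four mdifferentiable_theta3Four] at hP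
  simp only [thetaProd, Pi.add_apply, Pi.mul_apply] at h0 hW hP hJ hdJ
  generalize theta2Four τ = a at *
  generalize theta3Four τ = b at *
  generalize theta4Four τ = c at *
  generalize normalizedDerivOfComplex theta2Four τ = da at *
  generalize normalizedDerivOfComplex theta3Four τ = db at *
  generalize normalizedDerivOfComplex theta4Four τ = dc at *
  obtain ⟨⟨ha, hb⟩, hc⟩ : (a ≠ 0 ∧ b ≠ 0) ∧ c ≠ 0 := by simpa using h0
  subst hJ hdJ
  have hda : da = 1 / 6 * (E2 τ + (a + c) + c) * a := by
    refine mul_right_cancel₀ (mul_ne_zero hb hc) ?_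
    -- The multipliers eliminate `dc` and leave `da` with coefficient `c (a + c)`.
    linear_combination (1 / 6) * hP + (1 / 3) * (a + 2 * c) * hW
  have hdc : dc = 1 / 6 * (E2 τ - a - (a + c)) * c := by
    refine mul_left_cancel₀ ha ?_
    linear_combination -hW + c * hda
  exact ⟨hda, by linear_combination hda + hdc, hdc⟩

/-- The logarithmic derivative of `f⁴` is four times that of `f`, and `2πi / (6 · 4) = πi/12`. -/
lemma hasDerivAt_of_normalizedDeriv_pow_four {f : ℂ → ℂ} {F : ℍ → ℂ} {τ : ℍ} {e : ℂ}
    (hF : ∀ τ : ℍ, F τ = f τ ^ 4) (hf : DifferentiableAt ℂ f τ) (h0 : F τ ≠ 0)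
    (h : normalizedDerivOfComplex F τ = 1 / 6 * e * F τ) :
    HasDerivAt f (π * I / 12 * e * f τ) τ := by
  have hpi : (π : ℂ) ≠ 0 := ofReal_ne_zero.mpr Real.pi_ne_zero
  have hf0 : f τ ≠ 0 := fun h ↦ h0 (by simp [hF, h])
  rw [normalizedDeriv_restrict (f := fun z ↦ f z ^ 4) F hF, (hf.hasDerivAt.fun_pow 4).deriv, hF] at h
  push_cast at h
  have hd : deriv f τ = π * I / 12 * e * f τ := by
    field_simp [I_ne_zero] at h ⊢
    linear_combination h / 2
  exact hd ▸ hf.hasDerivAt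

lemma hasDerivAt_weierstrassEta (τ : ℍ) : HasDerivAt weierstrassEta
    (π ^ 2 / 12 * (2 * π * I * normalizedDerivOfComplex E2 τ)) τ := by
  have hpi : (π : ℂ) ≠ 0 := ofReal_ne_zero.mpr Real.pi_ne_zero
  have hd : DifferentiableAt ℂ (E2 ∘ ofComplex) τ :=
    UpperHalfPlane.mdifferentiableAt_iff.mp (E2_mdifferentiable τ)
  have h := hd.hasDerivAt.const_mul (π ^ 2 / 12 : ℂ)
  have he : 2 * π * I * normalizedDerivOfComplex E2 τ = deriv (E2 ∘ ofComplex) τ := by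
    rw [normalizedDerivOfComplex]
    field_simp [I_ne_zero]
  rw [he]
  refine h.congr_of_eventuallyEq ?_
  filter_upwards [isOpen_upperHalfPlaneSet.mem_nhds τ.2] with z hz
  rw [Function.comp_apply, ofComplex_apply_of_im_pos hz]
  exact weierstrassEta_eq_E2 ⟨z, hz⟩

end Derivatives

end ThetaSystem

/-! ### The differential system -/

theorem theorem5p1 (τ : ℂ) (hτ : 0 < τ.im) :
    HasDerivAt ThetaSystem.theta2
      (Complex.I / (Real.pi : ℂ) *
        (ThetaSystem.weierstrassEta τ +
          (Real.pi : ℂ) ^ 2 / 12 * (ThetaSystem.theta3 τ ^ 4 + ThetaSystem.theta4 τ ^ 4)) *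
        ThetaSystem.theta2 τ) τ ∧
    HasDerivAt ThetaSystem.theta3
      (Complex.I / (Real.pi : ℂ) *
        (ThetaSystem.weierstrassEta τ +
          (Real.pi : ℂ) ^ 2 / 12 * (ThetaSystem.theta2 τ ^ 4 - ThetaSystem.theta4 τ ^ 4)) *
        ThetaSystem.theta3 τ) τ ∧
    HasDerivAt ThetaSystem.theta4
      (Complex.I / (Real.pi : ℂ) *
        (ThetaSystem.weierstrassEta τ -
          (Real.pi : ℂ) ^ 2 / 12 * (ThetaSystem.theta2 τ ^ 4 + ThetaSystem.theta3 τ ^ 4)) *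
        ThetaSystem.theta4 τ) τ ∧
    HasDerivAt ThetaSystem.weierstrassEta
      (Complex.I / (Real.pi : ℂ) *
        (2 * ThetaSystem.weierstrassEta τ ^ 2 -
          (Real.pi : ℂ) ^ 4 / 12 ^ 2 *
            (ThetaSystem.theta2 τ ^ 8 + ThetaSystem.theta3 τ ^ 8 + ThetaSystem.theta4 τ ^ 8))) τ := by

  open ThetaSystem in
  lift τ to ℍ using hτ
  have hpi : (Real.pi : ℂ) ≠ 0 := Complex.ofReal_ne_zero.mpr Real.pi_ne_zero
  obtain ⟨h2, h3, h4⟩ := normalizedDeriv_thetaFour τ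
  -- Nonvanishing permits passing from fourth powers to the theta constants themselves.
  obtain ⟨⟨n2, n3⟩, n4⟩ : (theta2Four τ ≠ 0 ∧ theta3Four τ ≠ 0) ∧ theta4Four τ ≠ 0 := by
    simpa [thetaProd] using thetaProd_ne_zero τ
  have hη := weierstrassEta_eq_E2 τ
  refine ⟨?_, ?_, ?_, ?_⟩
  · convert hasDerivAt_of_normalizedDeriv_pow_four (F := theta2Four) (fun _ ↦ rfl)
      (differentiableAt_theta2 τ.2) n2
      (by rw [h2, add_assoc]) using 1
    rw [hη, theta3Four, theta4Four]
    field_simp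
  · convert hasDerivAt_of_normalizedDeriv_pow_four (F := theta3Four) (fun _ ↦ rfl)
      (differentiableAt_theta3 τ.2) n3
      (by rw [h3, add_sub_assoc]) using 1
    rw [hη, theta2Four, theta4Four]
    field_simp
  · convert hasDerivAt_of_normalizedDeriv_pow_four (F := theta4Four) (fun _ ↦ rfl)
      (differentiableAt_theta4 τ.2) n4
      (by rw [h4, sub_sub]) using 1
    rw [hη, theta2Four, theta3Four]
    field_simp
  · convert hasDerivAt_weierstrassEta τ using 1
    rw [hη, normalizedDeriv_E2, theta2Four, theta3Four, theta4Four]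
    field_simp
    ring
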